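/- For every integer $n\ge 0$ let $f_n=\sum_{j=0}^{n}\binom{n}{j}^3$ be the $n$-th Franel number, and let $B_n(x)=\sum_{k=0}^{n}\binom nk B_k x^{n-k}$ be the $n$-th Bernoulli polynomial, where $B_k$ are the Bernoulli numbers ($B_1=-\tfrac12$). Then for every prime $p>3$, $$\sum_{k=0}^{p-1}(-1)^k f_k\equiv\left(\frac p3\right)+\frac{2p^2}{3}\,B_{p-2}\!\left(\frac13\right)\pmod{p^3},$$ where $\left(\frac{p}{3}\right)$ is the Legendre symbol (of $p$ modulo the prime $3$) and the congruence is taken in the ring of rational numbers whose denominator is not divisible by $p$, that is, the difference of the two sides is $p^3$ times such a rational number. -/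

import Mathlib

/-- The `n`-th Franel number `∑_{k=0}^{n} C(n,k)^3`. -/
def franel (n : ℕ) : ℕ :=
  ∑ k ∈ Finset.range (n + 1), n.choose k ^ 3

/-- Congruence of rational numbers `a ≡ b (mod p ^ r)` in the ring of rationals with denominator
prime to `p`: the difference is `p ^ r` times a fraction whose denominator is not divisible
by `p`. -/
def RatModEq (p r : ℕ) (a b : ℚ) : Prop :=
  ∃ m n : ℤ, ¬ (p : ℤ) ∣ n ∧ a - b = (p : ℚ) ^ r * ((m : ℚ) / (n : ℚ))

/-! The Franel number f_n is the coefficient of t^n in (1+t)^n ∑ C(n,k)² t^k, and the inner sum is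
the diagonal form at ((1+X)^n, (1+X)^n). With u = 1+t and z = -t/u, the Toeplitz form obeys a
two-term relation (`toeplitzForm.one_add_X_mul`) that makes the alternating sum telescope: for odd n
it is the coefficient of t^(n-1) in u^n ⟨(1+X)^n, (1+X)^n⟩ / (1+t+t²)
(`sum_neg_one_pow_mul_franel`). The coefficients of 1/(1+t+t²) are values of the character χ mod 3.

For n = p write (1+X)^p = 1 + pA + X^p. Modulo t^p, X^p pairs to zero and ⟨1, A⟩ is evaluation at z,
so the numerator becomes 2 - u^p + p² u^p ⟨A, A⟩. The part 2 - u^p contributes exactly χ(p), and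
only ⟨A, A⟩ mod p remains. There A is a truncated logarithm, and applying t d/dt yields the
coefficients (3 + 2(-1)^k)/k² (`coeff_toeplitzForm_frobeniusDefect`). Doubling and reflecting
residues reduces the resulting sum to 4 ∑ χ(k)/k², hence to ∑_{j<p/3} j^(p-3) by Fermat; the
power-sum formula links this to B_{p-2}(1/3) (`bernoulli_eval_one_third`). -/

/-! ### The Toeplitz and diagonal bilinear forms -/

open Polynomial in
/-- The bilinear form on polynomials with `⟨X ^ k, X ^ l⟩ = t ^ min k l * z ^ |k - l|`. -/
noncomputable def toeplitzForm {S : Type*} [CommRing S] (t z : S) : S[X] →ₗ[S] S[X] →ₗ[S] S :=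
  (basisMonomials S).constr S fun k => (basisMonomials S).constr S fun l =>
    t ^ min k l * z ^ ((k - l) + (l - k))

open Polynomial in
/-- The bilinear form on polynomials with `⟨X ^ k, X ^ l⟩ = t ^ k` if `k = l` and `0` otherwise. -/
noncomputable def diagonalForm {S : Type*} [CommRing S] (t : S) : S[X] →ₗ[S] S[X] →ₗ[S] S :=
  (basisMonomials S).constr S fun k => (basisMonomials S).constr S fun l =>
    if k = l then t ^ k else 0

namespace toeplitzForm

open Polynomial

variable {S : Type*} [CommRing S] (t z : S)

theorem bilin_ext {f g : S[X] →ₗ[S] S[X] →ₗ[S] S}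
    (h : ∀ k l : ℕ, f (X ^ k) (X ^ l) = g (X ^ k) (X ^ l)) : f = g := by
  refine (basisMonomials S).ext fun k => (basisMonomials S).ext fun l => ?_
  simpa [coe_basisMonomials, ← X_pow_eq_monomial] using h k l

@[simp] theorem X_pow_X_pow (k l : ℕ) :
    toeplitzForm t z (X ^ k) (X ^ l) = t ^ min k l * z ^ ((k - l) + (l - k)) := by
  have h := (basisMonomials S).constr_basis S (fun k => (basisMonomials S).constr S fun l =>
    t ^ min k l * z ^ ((k - l) + (l - k))) k
  have h' := (basisMonomials S).constr_basis S (fun l =>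
    t ^ min k l * z ^ ((k - l) + (l - k))) l
  simp only [coe_basisMonomials, ← X_pow_eq_monomial] at h h'
  rw [toeplitzForm, h, h']

@[simp] theorem _root_.diagonalForm.X_pow_X_pow (k l : ℕ) :
    diagonalForm t (X ^ k) (X ^ l) = if k = l then t ^ k else 0 := by
  have h := (basisMonomials S).constr_basis S (fun k => (basisMonomials S).constr S fun l =>
    if k = l then t ^ k else 0) k
  have h' := (basisMonomials S).constr_basis S (fun l => if k = l then t ^ k else 0) l
  simp only [coe_basisMonomials, ← X_pow_eq_monomial] at h h'
  rw [diagonalForm, h, h']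

theorem comm (F G : S[X]) : toeplitzForm t z F G = toeplitzForm t z G F := by
  have : toeplitzForm t z = (toeplitzForm t z).flip := by
    refine bilin_ext fun k l => ?_
    rw [LinearMap.flip_apply, X_pow_X_pow, X_pow_X_pow, min_comm, add_comm]
  exact congrArg (fun f => f F G) this

theorem X_mul_X_mul (F G : S[X]) :
    toeplitzForm t z (X * F) (X * G) = t * toeplitzForm t z F G := by
  have : (toeplitzForm t z).compl₁₂ (LinearMap.mulLeft S X) (LinearMap.mulLeft S X) =
      t • toeplitzForm t z := by
    refine bilin_ext fun k l => ?_
    simp only [LinearMap.compl₁₂_apply, LinearMap.mulLeft_apply, LinearMap.smul_apply,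
      ← pow_succ', X_pow_X_pow, smul_eq_mul]
    rw [Nat.add_sub_add_right, Nat.add_sub_add_right, Nat.add_min_add_right, pow_succ']
    ring
  simpa using congrArg (fun f => f F G) this

theorem one_left (G : S[X]) : toeplitzForm t z 1 G = G.eval z := by
  have : toeplitzForm t z 1 = leval z := by
    refine (basisMonomials S).ext fun l => ?_
    have := X_pow_X_pow t z 0 l
    simpa [coe_basisMonomials, ← X_pow_eq_monomial] using this
  rw [this, leval_apply]

/-- When t ∣ z, the entry at (k, l) is divisible by t to the power min k l + |k - l| = max k l. -/
theorem pow_dvd_X_pow_left (htz : t ∣ z) (k : ℕ) (G : S[X]) :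
    t ^ k ∣ toeplitzForm t z (X ^ k) G := by
  induction G using Polynomial.induction_on' with
  | add p q hp hq => rw [map_add]; exact dvd_add hp hq
  | monomial l a =>
    rw [← C_mul_X_pow_eq_monomial, ← smul_eq_C_mul, map_smul, X_pow_X_pow, smul_eq_mul]
    refine Dvd.dvd.mul_left ?_ _
    rcases le_total k l with h | h
    · rw [min_eq_left h]; exact dvd_mul_right _ _
    · rw [min_eq_right h, Nat.sub_eq_zero_of_le h, add_zero]
      calc t ^ k = t ^ l * t ^ (k - l) := by rw [← pow_add, Nat.add_sub_cancel' h]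
        _ ∣ _ := mul_dvd_mul_left _ (pow_dvd_pow_of_dvd htz _)

/-- On monomials at distance d + 1 the left side is t^min z^d (u + z)(uz + t), which vanishes by the
choice of z; on the diagonal it is t^k (u² + 2uz + t). -/
theorem C_add_X_mul {u : S} (huz : u * z = -t) (F G : S[X]) :
    toeplitzForm t z ((C u + X) * F) ((C u + X) * G) = (u ^ 2 - t) * diagonalForm t F G := by
  have : (toeplitzForm t z).compl₁₂ (LinearMap.mulLeft S (C u + X)) (LinearMap.mulLeft S (C u + X)) =
      (u ^ 2 - t) • diagonalForm t := by
    refine bilin_ext fun k l => ?_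
    simp only [LinearMap.compl₁₂_apply, LinearMap.mulLeft_apply, LinearMap.smul_apply, add_mul,
      ← pow_succ', smul_eq_mul, ← smul_eq_C_mul, map_add, map_smul, LinearMap.add_apply,
      diagonalForm.X_pow_X_pow, X_pow_X_pow]
    rcases lt_trichotomy k l with h | rfl | h
    · obtain ⟨d, rfl⟩ := Nat.exists_eq_add_of_lt h
      rw [if_neg (by omega), show min k (k + d + 1) = k by omega,
        show k - (k + d + 1) + (k + d + 1 - k) = d + 1 by omega,
        show min k (k + d + 1 + 1) = k by omega,
        show k - (k + d + 1 + 1) + (k + d + 1 + 1 - k) = d + 2 by omega,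
        show min (k + 1) (k + d + 1) = k + 1 by omega,
        show k + 1 - (k + d + 1) + (k + d + 1 - (k + 1)) = d by omega,
        show min (k + 1) (k + d + 1 + 1) = k + 1 by omega,
        show k + 1 - (k + d + 1 + 1) + (k + d + 1 + 1 - (k + 1)) = d + 1 by omega]
      linear_combination (t ^ k * z ^ d * (u + z)) * huz
    · rw [if_pos rfl, show min k k = k by omega, show k - k + (k - k) = 0 by omega,
        show min k (k + 1) = k by omega, show k - (k + 1) + (k + 1 - k) = 1 by omega,
        show min (k + 1) k = k by omega, show k + 1 - k + (k - (k + 1)) = 1 by omega,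
        show min (k + 1) (k + 1) = k + 1 by omega,
        show k + 1 - (k + 1) + (k + 1 - (k + 1)) = 0 by omega]
      linear_combination (2 * t ^ k) * huz
    · obtain ⟨d, rfl⟩ := Nat.exists_eq_add_of_lt h
      rw [if_neg (by omega), show min (l + d + 1) l = l by omega,
        show (l + d + 1) - l + (l - (l + d + 1)) = d + 1 by omega,
        show min (l + d + 1) (l + 1) = l + 1 by omega,
        show (l + d + 1) - (l + 1) + (l + 1 - (l + d + 1)) = d by omega,
        show min (l + d + 1 + 1) l = l by omega,
        show l + d + 1 + 1 - l + (l - (l + d + 1 + 1)) = d + 2 by omega,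
        show min (l + d + 1 + 1) (l + 1) = l + 1 by omega,
        show l + d + 1 + 1 - (l + 1) + (l + 1 - (l + d + 1 + 1)) = d + 1 by omega]
      linear_combination (t ^ l * z ^ d * (u + z)) * huz
  simpa using congrArg (fun f => f F G) this

/-- Multiplication by `(1 + x) (1 + y) (1 + xy) + xy = (1 + xy + x) (1 + xy + y)`. -/
theorem one_add_X_mul {u : S} (hu : u = 1 + t) (huz : u * z = -t) (F G : S[X]) :
    u * toeplitzForm t z ((1 + X) * F) ((1 + X) * G) + t * toeplitzForm t z F G =
      (u ^ 2 - t) * diagonalForm t F G := by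
  rw [← C_add_X_mul t z huz]
  simp only [add_mul, one_mul, ← smul_eq_C_mul, map_add, map_smul, LinearMap.add_apply,
    LinearMap.smul_apply, smul_eq_mul, X_mul_X_mul]
  subst hu
  ring

theorem _root_.diagonalForm.one_add_X_pow (n : ℕ) :
    diagonalForm t ((1 + X) ^ n) ((1 + X) ^ n) =
      ∑ k ∈ Finset.range (n + 1), (n.choose k : S) ^ 2 * t ^ k := by
  have h : ((1 + X) ^ n : S[X]) = ∑ k ∈ Finset.range (n + 1), (n.choose k : S) • X ^ k := by
    rw [add_comm, add_pow]
    refine Finset.sum_congr rfl fun k _ => ?_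
    simp [smul_eq_C_mul, mul_comm]
  rw [h]
  simp only [map_sum, LinearMap.sum_apply, map_smul, LinearMap.smul_apply,
    diagonalForm.X_pow_X_pow, smul_eq_mul]
  refine Finset.sum_congr rfl fun k hk => ?_
  simp only [mul_ite, mul_zero, hk, Finset.sum_ite_eq', if_true]
  ring

end toeplitzForm

/-! ### The character mod 3 and the exact formula for the alternating sum -/

section

theorem legendreSym_three_eq (n : ℤ) :
    legendreSym 3 n = if n % 3 = 0 then 0 else if n % 3 = 1 then 1 else -1 := by
  rw [legendreSym.mod]
  have h : n % 3 = 0 ∨ n % 3 = 1 ∨ n % 3 = 2 := by omega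
  push_cast
  rcases h with h | h | h <;> rw [h] <;> decide

theorem legendreSym_three_sum (n : ℤ) :
    legendreSym 3 n + legendreSym 3 (n + 1) + legendreSym 3 (n + 2) = 0 := by
  simp only [legendreSym_three_eq]
  split_ifs <;> omega

theorem legendreSym_three_two_mul (n : ℤ) : legendreSym 3 (2 * n) = -legendreSym 3 n := by
  simp only [legendreSym_three_eq]
  split_ifs <;> omega

-- The functional X^k ↦ χ(k) kills the ideal of 1 + X + X², modulo which 1 + X ≡ -X². So (1+X)^n may
-- be replaced by -X^(2n) for odd n, and χ(2n) = -χ(n).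
open Polynomial in
theorem sum_choose_mul_legendreSym_three {n : ℕ} (hn : Odd n) :
    ∑ k ∈ Finset.range (n + 1), (n.choose k : ℤ) * legendreSym 3 k = legendreSym 3 n := by
  let τ : ℤ[X] →ₗ[ℤ] ℤ := (basisMonomials ℤ).constr ℤ fun k : ℕ => legendreSym 3 k
  have hτ (k : ℕ) : τ (X ^ k) = legendreSym 3 k := by
    have := (basisMonomials ℤ).constr_basis ℤ (fun k : ℕ => legendreSym 3 k) k
    simpa only [coe_basisMonomials, ← X_pow_eq_monomial] using this
  have hΦ (F : ℤ[X]) : τ ((1 + X + X ^ 2) * F) = 0 := by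
    have : τ ∘ₗ LinearMap.mulLeft ℤ (1 + X + X ^ 2) = 0 := by
      refine (basisMonomials ℤ).ext fun k => ?_
      simp only [coe_basisMonomials, ← X_pow_eq_monomial, LinearMap.comp_apply,
        LinearMap.mulLeft_apply, add_mul, one_mul, ← pow_succ', ← pow_add, map_add, hτ,
        LinearMap.zero_apply]
      rw [add_comm 2 k]
      exact_mod_cast legendreSym_three_sum k
    exact congrArg (fun f => f F) this
  obtain ⟨Q, hQ⟩ := sub_dvd_pow_sub_pow (1 + X : ℤ[X]) (-X ^ 2) n
  have h1 : (1 + X : ℤ[X]) ^ n = (1 + X + X ^ 2) * Q - X ^ (2 * n) := by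
    have : (-X ^ 2 : ℤ[X]) ^ n = - X ^ (2 * n) := by rw [hn.neg_pow, pow_mul]
    rw [this] at hQ
    linear_combination hQ
  have h2 : τ ((1 + X) ^ n) = legendreSym 3 n := by
    rw [h1, map_sub, hΦ, hτ]
    push_cast
    rw [legendreSym_three_two_mul, zero_sub, neg_neg]
  rw [← h2, add_comm 1 X, add_pow, map_sum]
  refine Finset.sum_congr rfl fun k _ => ?_
  rw [one_pow, mul_one, mul_comm (X ^ k), ← nsmul_eq_mul (n.choose k) (X ^ k : ℤ[X]), map_nsmul,
    hτ, nsmul_eq_mul]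

open PowerSeries

/-- The expansion of `1 / (1 + X + X ^ 2)`. -/
noncomputable def legendreSeries (R : Type*) [CommRing R] : R⟦X⟧ :=
  mk fun n => (legendreSym 3 (n + 1) : R)

theorem coeff_legendreSeries_mul {R : Type*} [CommRing R] (f : R⟦X⟧) (n : ℕ) :
    coeff n (legendreSeries R * f) =
      ∑ k ∈ Finset.range (n + 1), (legendreSym 3 ((n : ℤ) + 1 - k) : R) * coeff k f := by
  rw [mul_comm, coeff_mul, Finset.Nat.sum_antidiagonal_eq_sum_range_succ_mk]
  refine Finset.sum_congr rfl fun k hk => ?_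
  have hk' : k ≤ n := Nat.lt_succ_iff.mp (Finset.mem_range.mp hk)
  rw [legendreSeries, coeff_mk, mul_comm, Nat.cast_sub hk', sub_add_eq_add_sub]

theorem legendreSeries_mul (R : Type*) [CommRing R] :
    legendreSeries R * (1 + X + X ^ 2) = 1 := by
  ext n
  rw [mul_add, mul_add, mul_one, map_add, map_add, coeff_one, legendreSeries]
  rcases n with _ | _ | n
  · simp [coeff_mul_X_pow', legendreSym_three_eq]
  · simp [coeff_mul_X_pow', coeff_succ_mul_X, legendreSym_three_eq]
  · rw [coeff_succ_mul_X, coeff_mul_X_pow', if_pos (by omega), coeff_mk, coeff_mk, coeff_mk,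
      if_neg (by omega), show n + 1 + 1 - 2 = n by omega, ← Int.cast_add, ← Int.cast_add,
      ← Int.cast_zero]
    congr 1
    have := legendreSym_three_sum (n + 1)
    push_cast
    ring_nf at this ⊢
    linarith

theorem coeff_one_add_X_pow {R : Type*} [CommRing R] (n m : ℕ) :
    coeff m ((1 + X : R⟦X⟧) ^ n) = n.choose m := by
  have := Polynomial.coeff_coe ((1 + Polynomial.X : Polynomial R) ^ n) m
  rw [Polynomial.coeff_one_add_X_pow] at this
  rw [← this]; simp

theorem coeff_one_add_X_pow_mul_sum (n : ℕ) :
    coeff n ((1 + X : ℤ⟦X⟧) ^ n *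
      ∑ k ∈ Finset.range (n + 1), (n.choose k : ℤ⟦X⟧) ^ 2 * (X : ℤ⟦X⟧) ^ k) = franel n := by
  rw [Finset.mul_sum, map_sum, franel, Nat.cast_sum]
  refine Finset.sum_congr rfl fun k hk => ?_
  have hk' : k ≤ n := Nat.lt_succ_iff.mp (Finset.mem_range.mp hk)
  rw [← mul_assoc, coeff_mul_X_pow', if_pos hk', ← Nat.cast_pow, mul_comm, ← nsmul_eq_mul,
    map_nsmul, coeff_one_add_X_pow, Nat.choose_symm hk', nsmul_eq_mul]
  push_cast; ring

/-- The telescoping sum. -/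
theorem alternating_sum_mul_eq {S : Type*} [CommRing S] {t : S} (L δ : ℕ → S) (Φ : S)
    (h : ∀ n, L (n + 1) + t * L n = Φ * δ n) (n : ℕ) :
    Φ * ∑ k ∈ Finset.range n, (-1) ^ k * t ^ (n - 1 - k) * δ k = t ^ n * L 0 - (-1) ^ n * L n := by
  induction n with
  | zero => simp
  | succ n ih =>
    have : ∑ k ∈ Finset.range n, (-1) ^ k * t ^ (n + 1 - 1 - k) * δ k =
        t * ∑ k ∈ Finset.range n, (-1) ^ k * t ^ (n - 1 - k) * δ k := by
      rw [Finset.mul_sum]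
      refine Finset.sum_congr rfl fun k hk => ?_
      have := Finset.mem_range.mp hk
      rw [show n + 1 - 1 - k = (n - 1 - k) + 1 by omega]; ring
    rw [Finset.sum_range_succ, this, mul_add, mul_left_comm, ih, Nat.add_sub_cancel, Nat.sub_self]
    linear_combination (-(-1) ^ n) * h n

theorem sum_neg_one_pow_mul_franel {v : ℤ⟦X⟧} (hv : (1 + X) * v = 1) {n : ℕ} (hn : Odd n) :
    ∑ k ∈ Finset.range n, (-1 : ℤ) ^ k * franel k =
      coeff (n - 1) (legendreSeries ℤ * ((1 + X) ^ n *
        toeplitzForm X (-(X * v)) ((1 + Polynomial.X) ^ n) ((1 + Polynomial.X) ^ n))) := by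
  have huz : (1 + X) * -(X * v) = -X := by linear_combination (-X) * hv
  have key := alternating_sum_mul_eq (t := (X : ℤ⟦X⟧))
    (fun n => (1 + X) ^ n *
        toeplitzForm X (-(X * v)) ((1 + Polynomial.X) ^ n) ((1 + Polynomial.X) ^ n))
    (fun n => (1 + X) ^ n * diagonalForm X ((1 + Polynomial.X) ^ n) ((1 + Polynomial.X) ^ n))
    -- Here Φ = u² - t = 1 + t + t², the denominator cleared by `legendreSeries`.
    ((1 + X) ^ 2 - X) (fun n => by
      have := toeplitzForm.one_add_X_mul X (-(X * v)) rfl huz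
        ((1 + Polynomial.X) ^ n) ((1 + Polynomial.X) ^ n)
      simp only [← pow_succ'] at this
      linear_combination (1 + X) ^ n * this) n
  have h1 : ∑ k ∈ Finset.range n, (-1 : ℤ) ^ k * franel k = coeff (n - 1)
      (∑ k ∈ Finset.range n, (-1) ^ k * X ^ (n - 1 - k) *
        ((1 + X) ^ k * diagonalForm X ((1 + Polynomial.X) ^ k) ((1 + Polynomial.X) ^ k))) := by
    rw [map_sum]
    refine Finset.sum_congr rfl fun k hk => ?_
    have hk' := Finset.mem_range.mp hk
    have hC : ((-1) ^ k : ℤ⟦X⟧) = C ((-1) ^ k) := by simp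
    rw [diagonalForm.one_add_X_pow, mul_assoc, hC, coeff_C_mul, coeff_X_pow_mul',
      if_pos (Nat.sub_le _ _), Nat.sub_sub_self (by omega), coeff_one_add_X_pow_mul_sum]
  have h2 : ∑ k ∈ Finset.range n, (-1) ^ k * X ^ (n - 1 - k) *
        ((1 + X) ^ k * diagonalForm X ((1 + Polynomial.X) ^ k) ((1 + Polynomial.X) ^ k)) =
      legendreSeries ℤ * ((1 + X) ^ n *
        toeplitzForm X (-(X * v)) ((1 + Polynomial.X) ^ n) ((1 + Polynomial.X) ^ n)) +
      X ^ n * legendreSeries ℤ := by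
    have h0 : toeplitzForm X (-(X * v)) (1 : Polynomial ℤ⟦X⟧) 1 = 1 := by
      rw [toeplitzForm.one_left, Polynomial.eval_one]
    simp only [pow_zero, one_mul, h0, hn.neg_one_pow] at key
    have hD := legendreSeries_mul ℤ
    linear_combination legendreSeries ℤ * key - (∑ k ∈ Finset.range n, (-1) ^ k * X ^ (n - 1 - k) *
        ((1 + X) ^ k * diagonalForm X ((1 + Polynomial.X) ^ k) ((1 + Polynomial.X) ^ k))) * hD
  -- The boundary term of the telescoping starts in degree n, just beyond the coefficient read off.
  rw [h1, h2, map_add, coeff_X_pow_mul', if_neg (by have := hn.pos; omega), add_zero]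

/-- The constant 2 contributes 2χ(n), and the power removes one χ(n) by
`sum_choose_mul_legendreSym_three`. -/
theorem coeff_legendreSeries_mul_two_sub_pow {n : ℕ} (hn : Odd n) :
    coeff (n - 1) (legendreSeries ℤ * (2 - (1 + X) ^ n)) = legendreSym 3 n := by
  have hn0 : n - 1 + 1 = n := Nat.sub_add_cancel hn.pos
  have h1 : coeff (n - 1) (legendreSeries ℤ) = legendreSym 3 n := by
    rw [legendreSeries, coeff_mk, ← Nat.cast_succ, Nat.succ_eq_add_one, hn0, Int.cast_id]
  have h2 : coeff (n - 1) (legendreSeries ℤ * (1 + X) ^ n) = legendreSym 3 n := by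
    rw [coeff_legendreSeries_mul, hn0, ← sum_choose_mul_legendreSym_three hn,
      ← Finset.sum_range_reflect (fun k => (n.choose k : ℤ) * legendreSym 3 k) (n + 1),
      Finset.sum_range_succ _ n]
    have h0 : legendreSym 3 ((n + 1 - 1 - n : ℕ) : ℤ) = 0 := by
      rw [Nat.add_sub_cancel, Nat.sub_self, legendreSym_three_eq]; rfl
    rw [h0, mul_zero, add_zero]
    refine Finset.sum_congr rfl fun k hk => ?_
    have hk' := Finset.mem_range.mp hk
    rw [coeff_one_add_X_pow, Nat.add_sub_cancel, Nat.choose_symm hk'.le, Nat.cast_sub hk'.le,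
      mul_comm, ← Nat.cast_succ, Nat.succ_eq_add_one, hn0, Int.cast_id]
  rw [mul_sub, map_sub, h2, mul_two, map_add, h1]
  ring

end

/-! ### Specialisation to a prime index -/

section

open PowerSeries

/-- The polynomial `((1 + X) ^ p - 1 - X ^ p) / p`, for `p` prime. -/
noncomputable def frobeniusDefect (S : Type*) [CommRing S] (p : ℕ) : Polynomial S :=
  ∑ k ∈ Finset.Ico 1 p, ((p.choose k / p : ℕ) : S) • Polynomial.X ^ k

theorem one_add_X_pow_eq_frobeniusDefect (S : Type*) [CommRing S] {p : ℕ} (hp : p.Prime) :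
    (1 + Polynomial.X : Polynomial S) ^ p =
      1 + (p : S) • frobeniusDefect S p + Polynomial.X ^ p := by
  rw [add_comm (1 : Polynomial S) Polynomial.X, add_pow, Finset.sum_range_succ, Finset.range_eq_Ico,
    Finset.sum_eq_sum_Ico_succ_bot hp.pos, frobeniusDefect, Finset.smul_sum]
  simp only [one_pow, mul_one, pow_zero, Nat.choose_zero_right, Nat.cast_one,
    Nat.choose_self]
  congr 2
  refine Finset.sum_congr rfl fun k hk => ?_
  have hk' := Finset.mem_Ico.mp hk
  have h : (p.choose k : Polynomial S) = ((p * (p.choose k / p) : ℕ) : Polynomial S) := by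
    rw [Nat.mul_div_cancel' (hp.dvd_choose_self (by omega) hk'.2)]
  rw [h, smul_smul, ← Nat.cast_mul, Nat.cast_smul_eq_nsmul, nsmul_eq_mul, mul_comm]

/-- Since 1 + z = v = 1/u, the cross terms 2p⟨1, A⟩ equal 2(v^p - 1 - z^p); multiplied by u^p
together with ⟨1, 1⟩ = 1 they give 2 - u^p up to a multiple of t^p. -/
theorem X_pow_dvd_toeplitzForm_sub {S : Type*} [CommRing S] {p : ℕ} (hp : p.Prime)
    {t u v : S} (hu : u = 1 + t) (hv : u * v = 1) :
    t ^ p ∣ u ^ p * toeplitzForm t (-(t * v)) ((1 + Polynomial.X) ^ p) ((1 + Polynomial.X) ^ p) -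
      (2 - u ^ p + p ^ 2 * (u ^ p *
        toeplitzForm t (-(t * v)) (frobeniusDefect S p) (frobeniusDefect S p))) := by
  set z := -(t * v) with hz
  have htz : t ∣ z := (dvd_mul_right t v).neg_right
  set A := frobeniusDefect S p with hA
  have hzv : 1 + z = v := by rw [hz]; linear_combination v * hu - hv
  have h1 := one_add_X_pow_eq_frobeniusDefect S hp
  have h2 : A.eval z * p = v ^ p - 1 - z ^ p := by
    have := congrArg (Polynomial.eval z) h1
    simp only [Polynomial.eval_pow, Polynomial.eval_add, Polynomial.eval_one, Polynomial.eval_X,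
      Polynomial.eval_smul, smul_eq_mul, hzv] at this
    linear_combination -this
  have huv : u ^ p * v ^ p = 1 := by rw [← mul_pow, hv, one_pow]
  have h3 : toeplitzForm t z 1 1 = 1 := by rw [toeplitzForm.one_left, Polynomial.eval_one]
  have h4 : toeplitzForm t z 1 A = A.eval z := toeplitzForm.one_left ..
  have h5 : toeplitzForm t z A 1 = A.eval z := by rw [toeplitzForm.comm, h4]
  have h6 : toeplitzForm t z ((1 + Polynomial.X) ^ p) ((1 + Polynomial.X) ^ p) =
      1 + 2 * (v ^ p - 1 - z ^ p) + p ^ 2 * toeplitzForm t z A A +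
      toeplitzForm t z (Polynomial.X ^ p) (1 + (p : S) • A) +
      toeplitzForm t z (Polynomial.X ^ p) (1 + (p : S) • A + Polynomial.X ^ p) := by
    rw [h1, ← hA]
    generalize hP : (1 + (p : S) • A) = P
    rw [map_add (toeplitzForm t z) P, LinearMap.add_apply, map_add (toeplitzForm t z P),
      toeplitzForm.comm t z P (Polynomial.X ^ p), ← hP]
    simp only [map_add, map_smul, LinearMap.add_apply, LinearMap.smul_apply, smul_eq_mul, h3, h4,
      h5]
    linear_combination 2 * h2
  obtain ⟨a, ha⟩ := toeplitzForm.pow_dvd_X_pow_left t z htz p (1 + (p : S) • A)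
  obtain ⟨b, hb⟩ := toeplitzForm.pow_dvd_X_pow_left t z htz p
    (1 + (p : S) • A + Polynomial.X ^ p)
  -- The cofactors a and b come from the pairings with X^p, the last term from -2z^p.
  refine ⟨u ^ p * (a + b - 2 * (-v) ^ p), ?_⟩
  have hzp : z ^ p = t ^ p * (-v) ^ p := by rw [← mul_pow, hz]; ring
  rw [h6, ha, hb, hzp]
  linear_combination 2 * huv

theorem sum_neg_one_pow_mul_franel_prime {v : ℤ⟦X⟧} (hv : (1 + X) * v = 1) {p : ℕ}
    (hp : p.Prime) (hp2 : p ≠ 2) :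
    ∑ k ∈ Finset.range p, (-1 : ℤ) ^ k * franel k = legendreSym 3 p + p ^ 2 *
      coeff (p - 1) (legendreSeries ℤ * ((1 + X) ^ p *
        toeplitzForm X (-(X * v)) (frobeniusDefect _ p) (frobeniusDefect _ p))) := by
  have hodd := hp.odd_of_ne_two hp2
  obtain ⟨c, hc⟩ := X_pow_dvd_toeplitzForm_sub hp rfl hv
  have hpC : ((p : ℤ⟦X⟧) ^ 2) = C ((p : ℤ) ^ 2) := by simp
  rw [sum_neg_one_pow_mul_franel hv hodd, ← coeff_legendreSeries_mul_two_sub_pow hodd,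
    ← coeff_C_mul, ← hpC, ← map_add, ← sub_eq_zero, ← map_sub]
  have : X ^ p ∣ legendreSeries ℤ * ((1 + X) ^ p *
        toeplitzForm X (-(X * v)) ((1 + Polynomial.X) ^ p) ((1 + Polynomial.X) ^ p)) -
      (legendreSeries ℤ * (2 - (1 + X) ^ p) + (p : ℤ⟦X⟧) ^ 2 * (legendreSeries ℤ * ((1 + X) ^ p *
        toeplitzForm X (-(X * v)) (frobeniusDefect _ p) (frobeniusDefect _ p)))) :=
    ⟨legendreSeries ℤ * c, by linear_combination legendreSeries ℤ * hc⟩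
  exact X_pow_dvd_iff.mp this _ (Nat.sub_lt hp.pos one_pos)

theorem toeplitzForm_frobeniusDefect {S : Type*} [CommRing S] (t z : S) (p : ℕ) :
    toeplitzForm t z (frobeniusDefect S p) (frobeniusDefect S p) =
      ∑ k ∈ Finset.Ico 1 p, ∑ l ∈ Finset.Ico 1 p,
        ((p.choose k / p : ℕ) : S) * ((p.choose l / p : ℕ) : S) *
          (t ^ min k l * z ^ ((k - l) + (l - k))) := by
  rw [frobeniusDefect]
  simp only [map_sum, LinearMap.sum_apply, map_smul, LinearMap.smul_apply,
    toeplitzForm.X_pow_X_pow, smul_eq_mul, Finset.mul_sum]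
  rw [Finset.sum_comm]
  exact Finset.sum_congr rfl fun k _ => Finset.sum_congr rfl fun l _ => by ring

theorem toeplitzForm_frobeniusDefect_map {S S' : Type*} [CommRing S] [CommRing S'] (φ : S →+* S')
    (t z : S) (p : ℕ) :
    φ (toeplitzForm t z (frobeniusDefect S p) (frobeniusDefect S p)) =
      toeplitzForm (φ t) (φ z) (frobeniusDefect S' p) (frobeniusDefect S' p) := by
  simp [toeplitzForm_frobeniusDefect]

theorem legendreSeries_map {R R' : Type*} [CommRing R] [CommRing R'] (φ : R →+* R') :
    (legendreSeries R).map φ = legendreSeries R' := by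
  ext n; simp [legendreSeries]

/-- C(p,k)/p = C(p-1,k-1)/k, and C(p-1,m) ≡ (-1)^m by Pascal's rule mod p. -/
theorem cast_choose_div {p : ℕ} [Fact p.Prime] {k : ℕ} (hk : k ∈ Finset.Ico 1 p) :
    ((p.choose k / p : ℕ) : ZMod p) = (-1) ^ (k - 1) * (k : ZMod p)⁻¹ := by
  have hp : p.Prime := Fact.out
  obtain ⟨h1, h2⟩ := Finset.mem_Ico.mp hk
  have hk0 : (k : ZMod p) ≠ 0 := by
    rw [Ne, ZMod.natCast_eq_zero_iff]; exact Nat.not_dvd_of_pos_of_lt h1 h2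
  have h : p.choose k / p * k = (p - 1).choose (k - 1) := by
    apply Nat.eq_of_mul_eq_mul_left hp.pos
    have := Nat.add_one_mul_choose_eq (p - 1) (k - 1)
    rw [Nat.sub_add_cancel h1, Nat.sub_add_cancel hp.one_le] at this
    rw [← mul_assoc, Nat.mul_div_cancel' (hp.dvd_choose_self (by omega) h2), this]
  have hc (m : ℕ) (hm : m < p) : ((p - 1).choose m : ZMod p) = (-1) ^ m := by
    induction m with
    | zero => simp
    | succ m ih =>
      have h3 : (p.choose (m + 1) : ZMod p) = 0 := by
        rw [ZMod.natCast_eq_zero_iff]; exact hp.dvd_choose_self (by omega) hm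
      have h4 := Nat.choose_succ_succ (p - 1) m
      rw [Nat.succ_eq_add_one, Nat.succ_eq_add_one, Nat.sub_add_cancel hp.one_le] at h4
      rw [h4, Nat.cast_add, ih (by omega)] at h3
      rw [pow_succ]
      linear_combination h3
  have := congrArg (Nat.cast (R := ZMod p)) h
  rw [hc _ (by omega), Nat.cast_mul] at this
  rw [← this, mul_assoc, mul_inv_cancel₀ hk0, mul_one]

end

/-! ### Evaluation of ⟨A, A⟩ modulo p by the operator X d/dX -/

section

open PowerSeries

theorem sum_Ico_Ico_eq_diag_add {M : Type*} [AddCommMonoid M] (f : ℕ → ℕ → M) {a n : ℕ}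
    (h : a ≤ n) :
    ∑ k ∈ Finset.Ico a n, ∑ l ∈ Finset.Ico a n, f k l =
      ∑ k ∈ Finset.Ico a n, f k k +
        ∑ k ∈ Finset.Ico a n, ∑ l ∈ Finset.Ico a k, (f k l + f l k) := by
  induction n, h using Nat.le_induction with
  | base => simp
  | succ n hn ih =>
    simp only [Finset.sum_Ico_succ_top hn, Finset.sum_add_distrib, ih]
    abel

theorem X_mul_derivative_pow {R : Type*} [CommRing R] {f g : R⟦X⟧}
    (h : X * d⁄dX R f = g * f) (n : ℕ) : X * d⁄dX R (f ^ n) = (n : R⟦X⟧) * g * f ^ n := by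
  rcases n with _ | n
  · simp
  · rw [derivative_pow, Nat.add_sub_cancel, pow_succ]
    linear_combination ((n + 1 : ℕ) : R⟦X⟧) * f ^ n * h

/-- X d/dX multiplies the m-th coefficient by m, which is invertible for 0 < m < p. -/
theorem X_pow_dvd_of_dvd_X_mul_derivative {p : ℕ} [Fact p.Prime] {f : (ZMod p)⟦X⟧}
    (h0 : coeff 0 f = 0) (h : X ^ p ∣ X * d⁄dX (ZMod p) f) : X ^ p ∣ f := by
  rw [X_pow_dvd_iff] at h ⊢
  rintro (_ | m) hm
  · exact h0
  · have h1 := h (m + 1) hm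
    rw [coeff_succ_X_mul, coeff_derivative, mul_eq_zero] at h1
    refine h1.resolve_right ?_
    have : ((m + 1 : ℕ) : ZMod p) ≠ 0 := by
      rw [Ne, ZMod.natCast_eq_zero_iff]; exact Nat.not_dvd_of_pos_of_lt m.succ_pos hm
    exact_mod_cast this

section

variable {R : Type*} [CommRing R] {t v w : R}

/-- A geometric sum whose denominator t - w equals t * w. -/
theorem mul_sum_pow_mul_pow_sub (hw : w = t * v) (hv : (1 + t) * v = 1) {k : ℕ} (hk : 1 ≤ k) :
    w * ∑ l ∈ Finset.Ico 1 k, t ^ l * w ^ (k - l) = t ^ k * v - w ^ k := by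
  induction k, hk using Nat.le_induction with
  | base => simp [hw]
  | succ k hk ih =>
    have : ∑ l ∈ Finset.Ico 1 k, t ^ l * w ^ (k + 1 - l) =
        w * ∑ l ∈ Finset.Ico 1 k, t ^ l * w ^ (k - l) := by
      rw [Finset.mul_sum]
      refine Finset.sum_congr rfl fun l hl => ?_
      rw [Nat.sub_add_comm (Finset.mem_Ico.mp hl).2.le]; ring
    rw [Finset.sum_Ico_succ_top hk, this, Nat.add_sub_cancel_left, mul_add, ih]
    linear_combination (w * t ^ k + t ^ k) * hw + (w * t ^ k) * hv

theorem mul_sum_pow_sub (hvw : v + w = 1) {l n : ℕ} (h : l < n) :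
    v * ∑ k ∈ Finset.Ico (l + 1) n, w ^ (k - l) = w - w ^ (n - l) := by
  induction n, h using Nat.le_induction with
  | base => simp
  | succ n hn ih =>
    rw [Finset.sum_Ico_succ_top hn, mul_add, ih, Nat.sub_add_comm (by omega)]
    linear_combination w ^ (n - l) * hvw

end

/-- `∑ 0 < k < p, X ^ k / k`. -/
noncomputable def truncLog (p : ℕ) (w : (ZMod p)⟦X⟧) : (ZMod p)⟦X⟧ :=
  ∑ k ∈ Finset.Ico 1 p, C ((k : ZMod p)⁻¹) * w ^ k

theorem C_inv_mul_natCast {p : ℕ} [Fact p.Prime] {k : ℕ} (hk : k ∈ Finset.Ico 1 p) :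
    (C ((k : ZMod p)⁻¹) : (ZMod p)⟦X⟧) * (k : (ZMod p)⟦X⟧) = 1 := by
  obtain ⟨h1, h2⟩ := Finset.mem_Ico.mp hk
  have hk0 : (k : ZMod p) ≠ 0 := by
    rw [Ne, ZMod.natCast_eq_zero_iff]; exact Nat.not_dvd_of_pos_of_lt h1 h2
  rw [← map_natCast (C (R := ZMod p)), ← map_mul, inv_mul_cancel₀ hk0, map_one]

theorem X_mul_derivative_C_mul {R : Type*} [CommRing R] (a : R) (f : R⟦X⟧) :
    X * d⁄dX R (C a * f) = C a * (X * d⁄dX R f) := by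
  rw [← smul_eq_C_mul, (d⁄dX R).map_smul, smul_eq_C_mul]; ring

theorem X_mul_derivative_truncLog {p : ℕ} [Fact p.Prime] {w g : (ZMod p)⟦X⟧}
    (h : X * d⁄dX _ w = g * w) :
    X * d⁄dX _ (truncLog p w) = g * ∑ k ∈ Finset.Ico 1 p, w ^ k := by
  rw [truncLog, map_sum, Finset.mul_sum, Finset.mul_sum]
  refine Finset.sum_congr rfl fun k hk => ?_
  rw [X_mul_derivative_C_mul, X_mul_derivative_pow h]
  linear_combination g * w ^ k * C_inv_mul_natCast hk

theorem coeff_zero_truncLog {p : ℕ} {w : (ZMod p)⟦X⟧} (hw : X ∣ w) :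
    coeff 0 (truncLog p w) = 0 := by
  rw [coeff_zero_eq_constantCoeff_apply, ← X_dvd_iff]
  refine Finset.dvd_sum fun k hk => Dvd.dvd.mul_left (dvd_pow hw ?_) _
  have := Finset.mem_Ico.mp hk
  omega

variable {p : ℕ} [Fact p.Prime] {v w : (ZMod p)⟦X⟧}

theorem X_mul_derivative_inv_one_add_X {R : Type*} [CommRing R] {v w : R⟦X⟧}
    (hw : w = X * v) (hv : (1 + X) * v = 1) :
    X * d⁄dX R w = v * w := by
  have h := congrArg (d⁄dX R) hv
  rw [Derivation.leibniz] at h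
  simp only [map_add, derivative_X, derivative_one, smul_eq_mul] at h
  have hv' : d⁄dX R v = -v ^ 2 := by linear_combination v * h - d⁄dX R v * hv
  rw [hw, Derivation.leibniz, derivative_X, smul_eq_mul, smul_eq_mul, hv']
  linear_combination (-X * v) * hv

/-- The truncated form of -log(1 - w) = log(1 + X), from 1 - w = 1/(1 + X). -/
theorem truncLog_add_truncLog_neg_X (hp2 : p ≠ 2) (hw : w = X * v) (hv : (1 + X) * v = 1) :
    X ^ p ∣ truncLog p w + truncLog p (-X) := by
  have hp : p.Prime := Fact.out
  have hvw : v + w = 1 := by rw [hw, ← hv]; ring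
  have hXX : (X : (ZMod p)⟦X⟧) * d⁄dX _ (-X) = 1 * (-X) := by simp
  refine X_pow_dvd_of_dvd_X_mul_derivative ?_ ?_
  · rw [map_add, coeff_zero_truncLog (by rw [hw]; exact dvd_mul_right _ _),
      coeff_zero_truncLog (dvd_refl _).neg_right, add_zero]
  · rw [map_add, mul_add, X_mul_derivative_truncLog (X_mul_derivative_inv_one_add_X hw hv),
      X_mul_derivative_truncLog hXX, one_mul]
    have h1 := mul_sum_pow_sub hvw hp.pos
    have h2 := mul_sum_pow_sub (v := 1 + X) (w := (-X : (ZMod p)⟦X⟧)) (by ring) hp.pos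
    simp only [Nat.sub_zero, zero_add, (hp.odd_of_ne_two hp2).neg_pow] at h1 h2
    refine ⟨v - v ^ p, ?_⟩
    have h3 : w ^ p = X ^ p * v ^ p := by rw [hw, mul_pow]
    have h4 : (∑ k ∈ Finset.Ico 1 p, (-X : (ZMod p)⟦X⟧) ^ k) =
        v * ((1 + X) * ∑ k ∈ Finset.Ico 1 p, (-X : (ZMod p)⟦X⟧) ^ k) := by
      rw [← mul_assoc, mul_comm v, hv, one_mul]
    rw [h1, h4, h2, h3, hw]
    ring

/-- The strictly triangular part of the double sum of `X ^ min k l * w ^ |k - l| / (k * l)`. -/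
noncomputable def triangularSum (p : ℕ) (w : (ZMod p)⟦X⟧) : (ZMod p)⟦X⟧ :=
  ∑ k ∈ Finset.Ico 1 p, ∑ l ∈ Finset.Ico 1 k,
    C ((k : ZMod p)⁻¹) * (C ((l : ZMod p)⁻¹) * (X ^ l * w ^ (k - l)))

/-- X d/dX multiplies X^l w^(k-l) by l + (k-l)v = lw + kv. Dividing by kl leaves w/k + v/l, so one
inner sum in each piece becomes geometric. -/
theorem X_mul_derivative_triangularSum (hw : w = X * v) (hv : (1 + X) * v = 1) :
    X ^ p ∣ X * d⁄dX _ (triangularSum p w) - (truncLog p X - truncLog p w) := by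
  have hp : p.Prime := Fact.out
  have hvw : v + w = 1 := by rw [hw, ← hv]; ring
  have hX : (X : (ZMod p)⟦X⟧) * d⁄dX _ X = 1 * X := by simp
  have hw' := X_mul_derivative_inv_one_add_X hw hv
  have h1 : X * d⁄dX _ (triangularSum p w) =
      ∑ k ∈ Finset.Ico 1 p, C ((k : ZMod p)⁻¹) *
        (w * ∑ l ∈ Finset.Ico 1 k, X ^ l * w ^ (k - l)) +
      ∑ l ∈ Finset.Ico 1 p, C ((l : ZMod p)⁻¹) * X ^ l *
        (v * ∑ k ∈ Finset.Ico (l + 1) p, w ^ (k - l)) := by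
    have h2 : ∑ l ∈ Finset.Ico 1 p, C ((l : ZMod p)⁻¹) * X ^ l *
        (v * ∑ k ∈ Finset.Ico (l + 1) p, w ^ (k - l)) =
        ∑ k ∈ Finset.Ico 1 p, ∑ l ∈ Finset.Ico 1 k,
          C ((l : ZMod p)⁻¹) * X ^ l * (v * w ^ (k - l)) := by
      simp only [Finset.mul_sum]
      refine Finset.sum_comm' fun l k => ?_
      simp only [Finset.mem_Ico]
      omega
    rw [h2, triangularSum, map_sum, Finset.mul_sum, ← Finset.sum_add_distrib]
    refine Finset.sum_congr rfl fun k hk => ?_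
    rw [map_sum, Finset.mul_sum, Finset.mul_sum, Finset.mul_sum, ← Finset.sum_add_distrib]
    refine Finset.sum_congr rfl fun l hl => ?_
    have hl' : l ∈ Finset.Ico 1 p := by
      simp only [Finset.mem_Ico] at hk hl ⊢; omega
    have h3 : ((k - l : ℕ) : (ZMod p)⟦X⟧) = (k : (ZMod p)⟦X⟧) - (l : (ZMod p)⟦X⟧) :=
      Nat.cast_sub (Finset.mem_Ico.mp hl).2.le
    have h4 : X * d⁄dX _ (X ^ l * w ^ (k - l)) =
        ((l : (ZMod p)⟦X⟧) + ((k : (ZMod p)⟦X⟧) - (l : (ZMod p)⟦X⟧)) * v) * (X ^ l * w ^ (k - l)) := by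
      have ha := X_mul_derivative_pow hX l
      have hb := X_mul_derivative_pow hw' (k - l)
      rw [h3] at hb
      rw [Derivation.leibniz, smul_eq_mul, smul_eq_mul]
      linear_combination w ^ (k - l) * ha + X ^ l * hb
    rw [X_mul_derivative_C_mul, X_mul_derivative_C_mul, h4]
    have hck := C_inv_mul_natCast hk
    have hcl := C_inv_mul_natCast hl'
    generalize C ((k : ZMod p)⁻¹) = ck at *
    generalize C ((l : ZMod p)⁻¹) = cl at *
    linear_combination (X ^ l * w ^ (k - l) * cl * v) * hck +
      (X ^ l * w ^ (k - l) * ck * (1 - v)) * hcl - (X ^ l * w ^ (k - l) * ck) * hvw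
  have h5 : X * d⁄dX _ (triangularSum p w) = truncLog p X - truncLog p w -
      ∑ l ∈ Finset.Ico 1 p, C ((l : ZMod p)⁻¹) * (X ^ l * w ^ (p - l)) := by
    rw [h1, truncLog, truncLog, ← Finset.sum_add_distrib, ← Finset.sum_sub_distrib,
      ← Finset.sum_sub_distrib]
    refine Finset.sum_congr rfl fun k hk => ?_
    obtain ⟨hk1, hk2⟩ := Finset.mem_Ico.mp hk
    rw [mul_sum_pow_mul_pow_sub hw hv hk1, mul_sum_pow_sub hvw hk2]
    linear_combination (C ((k : ZMod p)⁻¹) * X ^ k) * hvw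
  -- The error terms X^l w^(p-l) are divisible by X^p because X ∣ w.
  rw [h5, sub_sub_cancel_left, dvd_neg]
  refine Finset.dvd_sum fun k hk => Dvd.dvd.mul_left ?_ _
  refine ⟨v ^ (p - k), ?_⟩
  rw [hw, mul_pow, ← mul_assoc, ← pow_add, Nat.add_sub_cancel' (Finset.mem_Ico.mp hk).2.le]

theorem triangularSum_sub_dvd (hp2 : p ≠ 2) (hw : w = X * v) (hv : (1 + X) * v = 1) :
    X ^ p ∣ triangularSum p w - ∑ k ∈ Finset.Ico 1 p,
      C ((1 + (-1) ^ k) * ((k : ZMod p)⁻¹) ^ 2) * X ^ k := by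
  have hp : p.Prime := Fact.out
  have hX : (X : (ZMod p)⟦X⟧) * d⁄dX _ X = 1 * X := by simp
  refine X_pow_dvd_of_dvd_X_mul_derivative ?_ ?_
  · have : X ∣ triangularSum p w - ∑ k ∈ Finset.Ico 1 p,
        C ((1 + (-1) ^ k) * ((k : ZMod p)⁻¹) ^ 2) * X ^ k := by
      refine dvd_sub (Finset.dvd_sum fun k _ => Finset.dvd_sum fun l hl =>
        Dvd.dvd.mul_left (Dvd.dvd.mul_left (Dvd.dvd.mul_right (dvd_pow_self _ ?_) _) _) _)
        (Finset.dvd_sum fun k hk => Dvd.dvd.mul_left (dvd_pow_self _ ?_) _)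
      · have := (Finset.mem_Ico.mp hl).1; omega
      · have := (Finset.mem_Ico.mp hk).1; omega
    simpa using X_dvd_iff.mp this
  · have h1 : X * d⁄dX _ (∑ k ∈ Finset.Ico 1 p,
        C ((1 + (-1) ^ k) * ((k : ZMod p)⁻¹) ^ 2) * (X : (ZMod p)⟦X⟧) ^ k) =
        truncLog p X + truncLog p (-X) := by
      rw [map_sum, Finset.mul_sum, truncLog, truncLog, ← Finset.sum_add_distrib]
      refine Finset.sum_congr rfl fun k hk => ?_
      rw [X_mul_derivative_C_mul, X_mul_derivative_pow hX, map_mul, map_pow, map_add, map_pow,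
        map_neg, map_one, neg_pow X]
      linear_combination ((1 + (-1) ^ k) * C ((k : ZMod p)⁻¹) * X ^ k) * C_inv_mul_natCast hk
    rw [map_sub, mul_sub, h1]
    obtain ⟨a, ha⟩ := X_mul_derivative_triangularSum (p := p) hw hv
    obtain ⟨b, hb⟩ := truncLog_add_truncLog_neg_X (p := p) hp2 hw hv
    exact ⟨a - b, by linear_combination ha - hb⟩

/-- The signs (-1)^(k-1), (-1)^(l-1) of A cancel against the sign of (-w)^|k-l|. -/
theorem toeplitzForm_frobeniusDefect_eq :
    toeplitzForm X (-w) (frobeniusDefect _ p) (frobeniusDefect _ p) =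
      ∑ k ∈ Finset.Ico 1 p, C (((k : ZMod p)⁻¹) ^ 2) * X ^ k + 2 * triangularSum p w := by
  have hp : p.Prime := Fact.out
  have hc {k : ℕ} (hk : k ∈ Finset.Ico 1 p) : ((p.choose k / p : ℕ) : (ZMod p)⟦X⟧) =
      (-1) ^ (k - 1) * C ((k : ZMod p)⁻¹) := by
    rw [← map_natCast (C (R := ZMod p)), cast_choose_div hk]; simp
  rw [toeplitzForm_frobeniusDefect, sum_Ico_Ico_eq_diag_add _ hp.one_le, triangularSum,
    Finset.mul_sum]
  congr 1
  · refine Finset.sum_congr rfl fun k hk => ?_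
    have h1 : ((-1 : (ZMod p)⟦X⟧) ^ (k - 1)) ^ 2 = 1 := by
      rw [← pow_mul, mul_comm, pow_mul, neg_one_sq, one_pow]
    rw [hc hk, min_self, Nat.sub_self, pow_zero, map_pow]
    linear_combination (C ((k : ZMod p)⁻¹) ^ 2 * X ^ k) * h1
  · refine Finset.sum_congr rfl fun k hk => ?_
    rw [Finset.mul_sum]
    refine Finset.sum_congr rfl fun l hl => ?_
    obtain ⟨hl1, hl2⟩ := Finset.mem_Ico.mp hl
    have hl' : l ∈ Finset.Ico 1 p := by
      simp only [Finset.mem_Ico] at hk hl ⊢; omega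
    have h1 : (-1 : (ZMod p)⟦X⟧) ^ (k - 1) * (-1) ^ (l - 1) * (-1) ^ (k - l) = 1 := by
      rw [← pow_add, ← pow_add]
      exact Even.neg_one_pow ⟨k - 1, by omega⟩
    rw [hc hk, hc hl', min_eq_right hl2.le, min_eq_left hl2.le, Nat.sub_eq_zero_of_le hl2.le,
      add_zero, zero_add, neg_pow]
    linear_combination (2 * C ((k : ZMod p)⁻¹) * C ((l : ZMod p)⁻¹) * X ^ l * w ^ (k - l)) * h1

theorem coeff_toeplitzForm_frobeniusDefect (hp2 : p ≠ 2) (hw : w = X * v) (hv : (1 + X) * v = 1)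
    {n : ℕ} (hn : n < p) :
    coeff n (toeplitzForm X (-w) (frobeniusDefect _ p) (frobeniusDefect _ p)) =
      (3 + 2 * (-1) ^ n) * ((n : ZMod p)⁻¹) ^ 2 := by
  have h1 : X ^ p ∣ toeplitzForm X (-w) (frobeniusDefect _ p) (frobeniusDefect _ p) -
      ∑ k ∈ Finset.Ico 1 p, C ((3 + 2 * (-1) ^ k) * ((k : ZMod p)⁻¹) ^ 2) * X ^ k := by
    obtain ⟨a, ha⟩ := triangularSum_sub_dvd (p := p) hp2 hw hv
    refine ⟨2 * a, ?_⟩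
    have : ∑ k ∈ Finset.Ico 1 p, C ((3 + 2 * (-1) ^ k) * ((k : ZMod p)⁻¹) ^ 2) *
        (X : (ZMod p)⟦X⟧) ^ k =
        ∑ k ∈ Finset.Ico 1 p, C (((k : ZMod p)⁻¹) ^ 2) * X ^ k +
        2 * ∑ k ∈ Finset.Ico 1 p, C ((1 + (-1) ^ k) * ((k : ZMod p)⁻¹) ^ 2) * X ^ k := by
      rw [Finset.mul_sum, ← Finset.sum_add_distrib]
      refine Finset.sum_congr rfl fun k _ => ?_
      simp only [map_mul, map_add, map_pow, map_neg, map_one, map_ofNat]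
      ring
    rw [toeplitzForm_frobeniusDefect_eq, this]
    linear_combination 2 * ha
  have h2 := X_pow_dvd_iff.mp h1 n hn
  rw [map_sub, sub_eq_zero] at h2
  rw [h2, map_sum]
  simp only [coeff_C_mul, coeff_X_pow, mul_ite, mul_one, mul_zero, Finset.sum_ite_eq,
    Finset.mem_Ico, hn, and_true]
  split_ifs with h
  · rfl
  · simp [show n = 0 by omega]

end

/-! ### Sums of χ(k)/k² over residues modulo p -/

/-- Doubling permutes the nonzero residues mod n. The actual integers 2j are kept, since χ is not
periodic mod n. -/
theorem sum_Ico_two_mul {M : Type*} [AddCommMonoid M] (f : ℕ → M) {n : ℕ} (hn : Odd n) :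
    ∑ j ∈ Finset.Ico 1 n, f (2 * j) =
      ∑ k ∈ Finset.Ico 1 n, if Even k then f k else f (n + k) := by
  obtain ⟨m, rfl⟩ := hn
  refine Finset.sum_nbij' (fun j => if j ≤ m then 2 * j else 2 * j - (2 * m + 1))
    (fun k => if Even k then k / 2 else (k + (2 * m + 1)) / 2) ?_ ?_ ?_ ?_ ?_
  · intro j hj
    simp only [Finset.mem_Ico] at hj ⊢
    split_ifs <;> omega
  · intro k hk
    simp only [Finset.mem_Ico, Nat.even_iff] at hk ⊢
    split_ifs <;> omega
  · intro j hj
    simp only [Finset.mem_Ico, Nat.even_iff] at hj ⊢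
    split_ifs <;> omega
  · intro k hk
    simp only [Finset.mem_Ico, Nat.even_iff] at hk ⊢
    split_ifs <;> omega
  · intro j hj
    simp only [Finset.mem_Ico, Nat.even_iff] at hj ⊢
    split_ifs with h1 h2 h2
    · rfl
    · omega
    · omega
    · congr 1; omega

theorem sum_Ico_one_reflect {M : Type*} [AddCommMonoid M] (f : ℕ → M) (n : ℕ) :
    ∑ k ∈ Finset.Ico 1 n, f (n - k) = ∑ k ∈ Finset.Ico 1 n, f k := by
  refine Finset.sum_nbij' (fun k => n - k) (fun k => n - k) ?_ ?_ ?_ ?_ fun _ _ => rfl <;>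
  · intro k hk
    simp only [Finset.mem_Ico] at hk ⊢
    omega

section

variable {p : ℕ} [Fact p.Prime]

theorem inv_sub_sq {k : ℕ} (hk : k ≤ p) :
    (((p - k : ℕ) : ZMod p)⁻¹) ^ 2 = ((k : ZMod p)⁻¹) ^ 2 := by
  rw [Nat.cast_sub hk, CharP.cast_eq_zero, zero_sub, inv_neg, neg_sq]

/-- Doubling preserves the sum and scales it by 1/4, while 3 is invertible. -/
theorem sum_inv_sq (hp3 : 3 < p) : ∑ k ∈ Finset.Ico 1 p, ((k : ZMod p)⁻¹) ^ 2 = 0 := by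
  have hp : p.Prime := Fact.out
  have h := sum_Ico_two_mul (fun k => ((k : ZMod p)⁻¹) ^ 2) (hp.odd_of_ne_two (by omega))
  simp only [Nat.cast_add, CharP.cast_eq_zero, zero_add, ite_self, Nat.cast_mul, mul_inv,
    mul_pow, ← Finset.mul_sum] at h
  have h2 : ((2 : ℕ) : ZMod p) ≠ 0 := by
    rw [Ne, ZMod.natCast_eq_zero_iff]; exact Nat.not_dvd_of_pos_of_lt two_pos (by omega)
  have h3 : ((3 : ℕ) : ZMod p) ≠ 0 := by
    rw [Ne, ZMod.natCast_eq_zero_iff]; exact Nat.not_dvd_of_pos_of_lt three_pos hp3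
  have h4 : (((2 : ℕ) : ZMod p)⁻¹) ^ 2 * ((2 : ℕ) : ZMod p) ^ 2 = 1 := by
    rw [← mul_pow, inv_mul_cancel₀ h2, one_pow]
  refine (mul_eq_zero.mp ?_).resolve_left h3
  push_cast at h h4 ⊢
  linear_combination (-4) * h + (∑ k ∈ Finset.Ico 1 p, ((k : ZMod p)⁻¹) ^ 2) * h4

/-- Let S be the full sum and E its even part. Summing over 2j gives -S/4, because χ(2) = -1;
reducing the arguments 2j gives 3E - S. -/
theorem four_mul_sum_even (hp3 : 3 < p) :
    4 * ∑ k ∈ Finset.Ico 1 p with Even k, (legendreSym 3 k : ZMod p) * ((k : ZMod p)⁻¹) ^ 2 =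
      ∑ k ∈ Finset.Ico 1 p, (legendreSym 3 k : ZMod p) * ((k : ZMod p)⁻¹) ^ 2 := by
  have hp : p.Prime := Fact.out
  have hodd : Odd p := hp.odd_of_ne_two (by omega)
  set g : ℕ → ZMod p := fun k => (legendreSym 3 k : ZMod p) * ((k : ZMod p)⁻¹) ^ 2 with hg
  have h := sum_Ico_two_mul g hodd
  have h2 : ((2 : ℕ) : ZMod p) ≠ 0 := by
    rw [Ne, ZMod.natCast_eq_zero_iff]; exact Nat.not_dvd_of_pos_of_lt two_pos (by omega)
  have h3 : ((3 : ℕ) : ZMod p) ≠ 0 := by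
    rw [Ne, ZMod.natCast_eq_zero_iff]; exact Nat.not_dvd_of_pos_of_lt three_pos hp3
  have h4 : (((2 : ℕ) : ZMod p)⁻¹) ^ 2 * ((2 : ℕ) : ZMod p) ^ 2 = 1 := by
    rw [← mul_pow, inv_mul_cancel₀ h2, one_pow]
  have h5 : ∑ j ∈ Finset.Ico 1 p, g (2 * j) =
      -(((2 : ℕ) : ZMod p)⁻¹) ^ 2 * ∑ j ∈ Finset.Ico 1 p, g j := by
    rw [Finset.mul_sum]
    refine Finset.sum_congr rfl fun j _ => ?_
    simp only [hg]
    rw [Nat.cast_mul (α := ℤ), Nat.cast_mul (α := ZMod p), mul_inv, Nat.cast_two (R := ℤ),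
      legendreSym_three_two_mul]
    push_cast; ring
  have h6 : ∑ k ∈ Finset.Ico 1 p, (if Even k then g k else g (p + k)) =
      ∑ k ∈ Finset.Ico 1 p, (if Even k then g k else -g k) +
      ∑ k ∈ Finset.Ico 1 p, (if Even k then g k else 0) := by
    rw [← sum_Ico_one_reflect (fun k => if Even k then g k else 0), ← Finset.sum_add_distrib]
    refine Finset.sum_congr rfl fun k hk => ?_
    have hk' := (Finset.mem_Ico.mp hk).2.le
    have hpar : Even (p - k) ↔ ¬ Even k := by
      rw [Nat.even_sub hk']
      simp [Nat.not_even_iff_odd.mpr hodd]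
    by_cases hke : Even k
    · simp [hke, hpar]
    -- A case check mod 3 that needs 3 ∤ p; for odd k the argument p - k is even, which produces the
    -- extra copy of E.
    · have h7 : legendreSym 3 ((p : ℤ) + k) = - legendreSym 3 k + legendreSym 3 ((p : ℤ) - k) := by
        have hp3' : (p : ℤ) % 3 ≠ 0 := by
          intro h
          have := (Nat.prime_dvd_prime_iff_eq Nat.prime_three hp).mp (by omega)
          omega
        simp only [legendreSym_three_eq]
        split_ifs <;> omega
      simp only [hke, if_false, hpar, not_false_eq_true, if_true, hg]
      rw [inv_sub_sq hk', Nat.cast_sub hk', Nat.cast_add, h7, Nat.cast_add, CharP.cast_eq_zero (ZMod p)]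
      push_cast; ring
  have h8 : ∑ k ∈ Finset.Ico 1 p, (if Even k then g k else -g k) =
      2 * ∑ k ∈ Finset.Ico 1 p, (if Even k then g k else 0) - ∑ k ∈ Finset.Ico 1 p, g k := by
    rw [Finset.mul_sum, ← Finset.sum_sub_distrib]
    refine Finset.sum_congr rfl fun k _ => ?_
    split_ifs <;> ring
  rw [Finset.sum_filter]
  rw [h5, h6, h8] at h
  generalize ∑ k ∈ Finset.Ico 1 p, g k = T at *
  generalize ∑ k ∈ Finset.Ico 1 p, (if Even k then g k else 0) = U at *
  rw [← sub_eq_zero]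
  refine (mul_eq_zero.mp ?_).resolve_left h3
  push_cast at h h4 ⊢
  linear_combination (-4) * h - T * h4

theorem sum_legendreSym_three_reflect (hp3 : 3 < p) :
    ∑ k ∈ Finset.Ico 1 p, (legendreSym 3 ((p : ℤ) - k) : ZMod p) *
        ((3 + 2 * (-1) ^ k) * ((k : ZMod p)⁻¹) ^ 2) =
      4 * ∑ k ∈ Finset.Ico 1 p, (legendreSym 3 k : ZMod p) * ((k : ZMod p)⁻¹) ^ 2 := by
  have hp : p.Prime := Fact.out
  have hodd : Odd p := hp.odd_of_ne_two (by omega)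
  have h1 : ∑ k ∈ Finset.Ico 1 p, (legendreSym 3 ((p : ℤ) - k) : ZMod p) *
        ((3 + 2 * (-1) ^ k) * ((k : ZMod p)⁻¹) ^ 2) =
      5 * ∑ k ∈ Finset.Ico 1 p, (legendreSym 3 k : ZMod p) * ((k : ZMod p)⁻¹) ^ 2 -
      4 * ∑ k ∈ Finset.Ico 1 p with Even k,
        (legendreSym 3 k : ZMod p) * ((k : ZMod p)⁻¹) ^ 2 := by
    rw [Finset.sum_filter, Finset.mul_sum, Finset.mul_sum, ← Finset.sum_sub_distrib,
      ← sum_Ico_one_reflect]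
    refine Finset.sum_congr rfl fun k hk => ?_
    have hk' := (Finset.mem_Ico.mp hk).2.le
    rw [inv_sub_sq hk', Nat.cast_sub hk', sub_sub_cancel]
    by_cases hke : Even k
    · rw [(Nat.Odd.sub_even hk' hodd hke).neg_one_pow, if_pos hke]; ring
    · rw [(Nat.Odd.sub_odd hodd (Nat.not_even_iff_odd.mp hke)).neg_one_pow, if_neg hke]; ring
  rw [h1, four_mul_sum_even hp3]
  ring

theorem three_mul_sum_legendreSym_three (hp3 : 3 < p) :
    3 * ((legendreSym 3 p : ZMod p) *
        ∑ k ∈ Finset.Ico 1 p, (legendreSym 3 k : ZMod p) * ((k : ZMod p)⁻¹) ^ 2) =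
      ∑ j ∈ Finset.range ((p + 2) / 3), (j : ZMod p) ^ (p - 3) := by
  have hp : p.Prime := Fact.out
  have h3p : ¬ 3 ∣ p := fun h => by
    have := (Nat.prime_dvd_prime_iff_eq Nat.prime_three hp).mp h
    omega
  have h3 : ((3 : ℕ) : ZMod p) ≠ 0 := by
    rw [Ne, ZMod.natCast_eq_zero_iff]; exact Nat.not_dvd_of_pos_of_lt three_pos hp3
  set R := ∑ k ∈ Finset.Ico 1 p, if 3 ∣ k then ((k : ZMod p)⁻¹) ^ 2 else 0 with hR
  have h1 : (legendreSym 3 p : ZMod p) *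
      ∑ k ∈ Finset.Ico 1 p, (legendreSym 3 k : ZMod p) * ((k : ZMod p)⁻¹) ^ 2 = 3 * R := by
    -- Termwise this is χ(p)χ(k) = 2·[3 ∣ p - k] + [3 ∣ k] - 1.
    have h2 : 3 * R = 2 * (∑ k ∈ Finset.Ico 1 p,
        if 3 ∣ p - k then (((p - k : ℕ) : ZMod p)⁻¹) ^ 2 else 0) + R -
        ∑ k ∈ Finset.Ico 1 p, ((k : ZMod p)⁻¹) ^ 2 := by
      rw [sum_inv_sq hp3, sum_Ico_one_reflect (fun k => if 3 ∣ k then ((k : ZMod p)⁻¹) ^ 2 else 0)]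
      ring
    rw [h2, hR, Finset.mul_sum, Finset.mul_sum, ← Finset.sum_add_distrib,
      ← Finset.sum_sub_distrib]
    refine Finset.sum_congr rfl fun k hk => ?_
    have hk' := (Finset.mem_Ico.mp hk).2.le
    rw [inv_sub_sq hk', ← mul_assoc, ← Int.cast_mul, legendreSym_three_eq, legendreSym_three_eq]
    have hp' : (p : ℤ) % 3 = 1 ∨ (p : ℤ) % 3 = 2 := by omega
    have hk3 : (k : ℤ) % 3 = 0 ∨ (k : ℤ) % 3 = 1 ∨ (k : ℤ) % 3 = 2 := by omega
    rcases hp' with h | h <;> rcases hk3 with h' | h' | h' <;> rw [h, h']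
    · rw [if_neg (show ¬ 3 ∣ p - k by omega), if_pos (show 3 ∣ k by omega)]
      norm_num
    · rw [if_pos (show 3 ∣ p - k by omega), if_neg (show ¬ 3 ∣ k by omega)]
      norm_num; ring
    · rw [if_neg (show ¬ 3 ∣ p - k by omega), if_neg (show ¬ 3 ∣ k by omega)]
      norm_num
    · rw [if_neg (show ¬ 3 ∣ p - k by omega), if_pos (show 3 ∣ k by omega)]
      norm_num
    · rw [if_neg (show ¬ 3 ∣ p - k by omega), if_neg (show ¬ 3 ∣ k by omega)]
      norm_num
    · rw [if_pos (show 3 ∣ p - k by omega), if_neg (show ¬ 3 ∣ k by omega)]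
      norm_num; ring
  -- (p + 2) / 3 is the ceiling of p/3, so the range is exactly 0 < 3j < p.
  have h4 : R = ∑ j ∈ Finset.Ico 1 ((p + 2) / 3), (((3 * j : ℕ) : ZMod p)⁻¹) ^ 2 := by
    rw [hR, ← Finset.sum_filter]
    symm
    refine Finset.sum_nbij' (fun j => 3 * j) (fun k => k / 3) ?_ ?_ ?_ ?_ ?_
    · intro j hj; simp only [Finset.mem_Ico, Finset.mem_filter] at hj ⊢; omega
    · intro j hj; simp only [Finset.mem_Ico, Finset.mem_filter] at hj ⊢; omega
    · intro j hj; simp only [Finset.mem_Ico] at hj ⊢; omega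
    · intro j hj; simp only [Finset.mem_Ico, Finset.mem_filter] at hj ⊢; omega
    · intro j _; rfl
  rw [h1, h4, Finset.range_eq_Ico,
    Finset.sum_eq_sum_Ico_succ_bot (show 0 < (p + 2) / 3 by omega), Nat.cast_zero,
    zero_pow (by omega), zero_add, Finset.mul_sum, Finset.mul_sum]
  refine Finset.sum_congr rfl fun j hj => ?_
  rw [Finset.mem_Ico] at hj
  have hj0 : (j : ZMod p) ≠ 0 := by
    rw [Ne, ZMod.natCast_eq_zero_iff]; exact Nat.not_dvd_of_pos_of_lt (by omega) (by omega)
  have hj1 : (j : ZMod p) ^ (p - 3) * (j : ZMod p) ^ 2 = 1 := by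
    rw [← pow_add, show p - 3 + 2 = p - 1 by omega, ZMod.pow_card_sub_one_eq_one hj0]
  have h3' : (3 : ZMod p) ≠ 0 := by exact_mod_cast h3
  rw [eq_inv_of_mul_eq_one_left hj1, Nat.cast_mul, Nat.cast_ofNat, mul_inv, mul_pow, inv_pow,
    inv_pow]
  field_simp

end

/-! ### The congruence in terms of power sums -/

open PowerSeries in
/-- The supercongruence in terms of power sums. -/
theorem exists_sum_franel_eq {p : ℕ} (hp : p.Prime) (hp3 : 3 < p) :
    ∃ y d : ℤ, ∑ k ∈ Finset.range p, (-1 : ℤ) ^ k * franel k = legendreSym 3 p + p ^ 2 * y ∧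
      3 * y = 4 * (legendreSym 3 p * ∑ j ∈ Finset.range ((p + 2) / 3), (j : ℤ) ^ (p - 3)) +
        p * d := by
  have := Fact.mk hp
  obtain ⟨v, hv⟩ : ∃ v : ℤ⟦X⟧, (1 + X) * v = 1 := by
    have : IsUnit (1 + X : ℤ⟦X⟧) := by rw [isUnit_iff_constantCoeff]; simp
    exact this.exists_right_inv
  have hp2 : p ≠ 2 := by omega
  obtain ⟨y, hy⟩ : ∃ y, y = coeff (p - 1) (legendreSeries ℤ * ((1 + X) ^ p *
    toeplitzForm X (-(X * v)) (frobeniusDefect _ p) (frobeniusDefect _ p))) := ⟨_, rfl⟩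
  have hsum := sum_neg_one_pow_mul_franel_prime hv hp hp2
  rw [← hy] at hsum
  have hX2 : legendreSym 3 p * legendreSym 3 p = 1 := by
    have h3p : ¬ 3 ∣ p := fun h => by
      have := (Nat.prime_dvd_prime_iff_eq Nat.prime_three hp).mp h
      omega
    rw [legendreSym_three_eq]
    split_ifs
    · omega
    · rfl
    · rfl
  suffices h : ((3 * y : ℤ) : ZMod p) =
      ((4 * (legendreSym 3 p * ∑ j ∈ Finset.range ((p + 2) / 3), (j : ℤ) ^ (p - 3)) : ℤ) :
        ZMod p) by
    rw [ZMod.intCast_eq_intCast_iff_dvd_sub] at h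
    obtain ⟨d, hd⟩ := h
    exact ⟨y, -d, hsum, by linear_combination -hd⟩
  set φ := Int.castRingHom (ZMod p) with hφ
  have hv' : (1 + X) * PowerSeries.map φ v = 1 := by
    have := congrArg (PowerSeries.map φ) hv
    simpa using this
  have hyp : (y : ZMod p) = ∑ k ∈ Finset.Ico 1 p, (legendreSym 3 ((p : ℤ) - k) : ZMod p) *
        ((3 + 2 * (-1) ^ k) * ((k : ZMod p)⁻¹) ^ 2) := by
    have h1 : (y : ZMod p) = coeff (p - 1) (legendreSeries (ZMod p) * ((1 + X) ^ p *
        toeplitzForm X (-(X * PowerSeries.map φ v)) (frobeniusDefect _ p)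
          (frobeniusDefect _ p))) := by
      have h2 : (y : ZMod p) = φ y := rfl
      rw [h2, hy, ← coeff_map, map_mul (PowerSeries.map φ), map_mul (PowerSeries.map φ),
        legendreSeries_map,
        toeplitzForm_frobeniusDefect_map]
      simp
    have : CharP (ZMod p)⟦X⟧ p := charP_of_injective_ringHom (C_injective (R := ZMod p)) p
    -- In characteristic p, (1+X)^p = 1 + X^p does not affect the coefficient of degree p - 1.
    rw [h1, add_pow_char, one_pow, add_mul, one_mul, mul_add, map_add, mul_left_comm,
      coeff_X_pow_mul', if_neg (by have := hp.pos; omega), add_zero, coeff_legendreSeries_mul,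
      Nat.sub_add_cancel hp.one_le, Finset.range_eq_Ico, Finset.sum_eq_sum_Ico_succ_bot hp.pos]
    have hcoeff {n : ℕ} (hn : n < p) :=
      coeff_toeplitzForm_frobeniusDefect hp2 (rfl : X * PowerSeries.map φ v = _) hv' hn
    -- At index 0 the formula gives the correct value 0 through the convention 0⁻¹ = 0.
    rw [hcoeff hp.pos]
    simp only [Nat.cast_zero, inv_zero, ne_eq, OfNat.ofNat_ne_zero, not_false_eq_true, zero_pow,
      mul_zero, zero_add]
    refine Finset.sum_congr rfl fun k hk => ?_
    rw [hcoeff (Finset.mem_Ico.mp hk).2, Nat.cast_sub hp.one_le, Nat.cast_one, sub_add_cancel]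
  have hs := three_mul_sum_legendreSym_three (p := p) hp3
  have hX2' := congrArg (Int.cast (R := ZMod p)) hX2
  push_cast at hX2' ⊢
  rw [hyp, sum_legendreSym_three_reflect hp3, ← hs]
  linear_combination (-12 * ∑ k ∈ Finset.Ico 1 p,
    (legendreSym 3 k : ZMod p) * ((k : ZMod p)⁻¹) ^ 2) * hX2'

/-! ### Bernoulli polynomials modulo p and the conclusion -/

/-- `p`-integral rational numbers satisfy congruences modulo `p ^ r` in the sense of `RatModEq`. -/
theorem ratModEq_of_mem_integer {p r : ℕ} [Fact p.Prime] {a b c : ℚ}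
    (hc : c ∈ (Rat.padicValuation p).integer) (h : a - b = p ^ r * c) : RatModEq p r a b := by
  rw [Valuation.mem_integer_iff, Rat.padicValuation_le_one_iff] at hc
  exact ⟨c.num, c.den, by exact_mod_cast hc, by rw [h, Int.cast_natCast, Rat.num_div_den]⟩

theorem inv_natCast_mem_integer {p : ℕ} [Fact p.Prime] {n : ℕ} (hn : 0 < n) (hnp : n < p) :
    ((n : ℚ)⁻¹) ∈ (Rat.padicValuation p).integer := by
  rw [Valuation.mem_integer_iff, Rat.padicValuation_le_one_iff, Rat.inv_natCast_den_of_pos hn]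
  exact Nat.not_dvd_of_pos_of_lt hn hnp

/-- The recursion for B_n divides only by n + 1 < p. -/
theorem bernoulli_mem_integer {p : ℕ} [Fact p.Prime] {n : ℕ} (hn : n + 1 < p) :
    bernoulli n ∈ (Rat.padicValuation p).integer := by
  induction n using Nat.strong_induction_on with
  | _ n ih =>
    have h := sum_bernoulli (n + 1)
    rw [Finset.sum_range_succ, Nat.choose_succ_self_right] at h
    have hn0 : ((n + 1 : ℕ) : ℚ) ≠ 0 := Nat.cast_ne_zero.mpr n.succ_ne_zero
    have h' : bernoulli n = ((n + 1 : ℕ) : ℚ)⁻¹ * ((if n + 1 = 1 then 1 else 0) -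
        ∑ k ∈ Finset.range n, ((n + 1).choose k : ℚ) * bernoulli k) := by
      rw [← h, add_sub_cancel_left, inv_mul_cancel_left₀ hn0]
    rw [h']
    refine mul_mem (inv_natCast_mem_integer n.succ_pos hn) (sub_mem ?_ (sum_mem fun k hk => ?_))
    · split_ifs
      · exact one_mem _
      · exact zero_mem _
    · have hk' := Finset.mem_range.mp hk
      exact mul_mem (natCast_mem _ _) (ih k hk' (by omega))

theorem bernoulli_eval_sub_eval {p : ℕ} [Fact p.Prime] {n : ℕ} (hn : n + 1 < p) {x y c : ℚ}
    (hx : x ∈ (Rat.padicValuation p).integer) (hy : y ∈ (Rat.padicValuation p).integer)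
    (hc : c ∈ (Rat.padicValuation p).integer) (hxy : x - y = p * c) :
    ∃ d ∈ (Rat.padicValuation p).integer,
      (Polynomial.bernoulli n).eval x - (Polynomial.bernoulli n).eval y = p * d := by
  have hpow (m : ℕ) : ∃ d ∈ (Rat.padicValuation p).integer, x ^ m - y ^ m = p * d := by
    refine ⟨c * ∑ i ∈ Finset.range m, x ^ i * y ^ (m - 1 - i), mul_mem hc (sum_mem fun i _ =>
      mul_mem (pow_mem hx _) (pow_mem hy _)), ?_⟩
    rw [← geom_sum₂_mul, hxy]; ring
  choose d hd hd' using hpow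
  refine ⟨∑ i ∈ Finset.range (n + 1), bernoulli i * n.choose i * d (n - i),
    sum_mem fun i hi => mul_mem (mul_mem
      (bernoulli_mem_integer (by have := Finset.mem_range.mp hi; omega)) (natCast_mem _ _))
      (hd _), ?_⟩
  simp only [Polynomial.bernoulli, Polynomial.eval_finsetSum, Polynomial.eval_monomial]
  rw [← Finset.sum_sub_distrib, Finset.mul_sum]
  refine Finset.sum_congr rfl fun i _ => ?_
  linear_combination (bernoulli i * n.choose i) * hd' (n - i)

/-- The value at `1 / 3` of the Bernoulli polynomial as a power sum modulo `p`. -/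
theorem bernoulli_eval_one_third {p : ℕ} [Fact p.Prime] (hp3 : 3 < p) :
    ∃ d ∈ (Rat.padicValuation p).integer,
      (Polynomial.bernoulli (p - 2)).eval (1 / 3 : ℚ) =
        2 * (legendreSym 3 p * ∑ j ∈ Finset.range ((p + 2) / 3), (j : ℚ) ^ (p - 3)) + p * d := by
  have hp : p.Prime := Fact.out
  have hodd : Odd (p - 2) := Nat.Odd.sub_even (by omega) (hp.odd_of_ne_two (by omega)) even_two
  have h3p : ¬ 3 ∣ p := fun h => by
    have := (Nat.prime_dvd_prime_iff_eq Nat.prime_three hp).mp h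
    omega
  have h5 : 5 ≤ p := by
    have : p ≠ 4 := by rintro rfl; exact absurd hp (by decide)
    omega
  have h3 : ((3 : ℕ) : ℚ)⁻¹ ∈ (Rat.padicValuation p).integer :=
    inv_natCast_mem_integer three_pos hp3
  set s := ∑ j ∈ Finset.range ((p + 2) / 3), (j : ℚ) ^ (p - 3) with hs
  have hsum : (Polynomial.bernoulli (p - 2)).eval (((p + 2) / 3 : ℕ) : ℚ) = (p - 2) * s := by
    have h := Polynomial.sum_range_pow_eq_bernoulli_sub ((p + 2) / 3) (p - 3)
    rw [Nat.succ_eq_add_one, show p - 3 + 1 = p - 2 by omega,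
      bernoulli_eq_zero_of_odd hodd (by omega), sub_zero, ← hs, Nat.cast_sub hp3.le] at h
    rw [← h]; push_cast; ring
  have hsmem : s ∈ (Rat.padicValuation p).integer :=
    sum_mem fun j _ => pow_mem (natCast_mem _ _) _
  -- The upper limit (p + 2) / 3 is congruent to 2/3 or 1/3 mod p. In the first case the odd
  -- reflection B(1 - x) = -B(x) turns 2/3 into 1/3, which accounts for the sign χ(p).
  have hp12 : p % 3 = 1 ∨ p % 3 = 2 := by omega
  rcases hp12 with h | h
  · have hJ : (((p + 2) / 3 : ℕ) : ℚ) - 2 * ((3 : ℕ) : ℚ)⁻¹ = p * ((3 : ℕ) : ℚ)⁻¹ := by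
      have : ((3 * ((p + 2) / 3) : ℕ) : ℚ) = ((p + 2 : ℕ) : ℚ) := by congr 1; omega
      push_cast at this ⊢; linarith
    obtain ⟨d, hd, hd'⟩ := bernoulli_eval_sub_eval (n := p - 2) (by omega) (natCast_mem _ _)
      (mul_mem (ofNat_mem _ 2) h3) h3 hJ
    have hrefl := Polynomial.bernoulli_eval_one_sub (p - 2) (1 / 3)
    rw [hodd.neg_one_pow] at hrefl
    have h23 : (2 * ((3 : ℕ) : ℚ)⁻¹) = 1 - 1 / 3 := by norm_num
    rw [hsum, h23, hrefl] at hd'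
    have hl : legendreSym 3 p = 1 := by
      rw [legendreSym_three_eq, if_neg (by omega), if_pos (by omega)]
    refine ⟨d - s, sub_mem hd hsmem, ?_⟩
    rw [hl]; push_cast
    linear_combination hd'
  · have hJ : (((p + 2) / 3 : ℕ) : ℚ) - ((3 : ℕ) : ℚ)⁻¹ = p * ((3 : ℕ) : ℚ)⁻¹ := by
      have : ((3 * ((p + 2) / 3) : ℕ) : ℚ) = ((p + 1 : ℕ) : ℚ) := by congr 1; omega
      push_cast at this ⊢; linarith
    obtain ⟨d, hd, hd'⟩ := bernoulli_eval_sub_eval (n := p - 2) (by omega) (natCast_mem _ _)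
      h3 h3 hJ
    have h13 : ((3 : ℕ) : ℚ)⁻¹ = 1 / 3 := by norm_num
    rw [hsum, h13] at hd'
    have hl : legendreSym 3 p = -1 := by
      rw [legendreSym_three_eq, if_neg (by omega), if_neg (by omega)]
    refine ⟨s - d, sub_mem hsmem hd, ?_⟩
    rw [hl]; push_cast
    linear_combination -hd'

theorem theorem1p2 (p : ℕ) (hp : p.Prime) (hp3 : 3 < p) :
    RatModEq p 3
      (∑ k ∈ Finset.range p, (-1 : ℚ) ^ k * (franel k : ℚ))
      ((legendreSym 3 (p : ℤ) : ℚ) +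
        2 * (p : ℚ) ^ 2 / 3 * (Polynomial.bernoulli (p - 2)).eval (1 / 3 : ℚ)) := by
  have := Fact.mk hp
  obtain ⟨y, d, hsum, hy⟩ := exists_sum_franel_eq hp hp3
  obtain ⟨e, he, hB⟩ := bernoulli_eval_one_third (p := p) hp3
  have hsum' := congrArg (Int.cast (R := ℚ)) hsum
  have hy' := congrArg (Int.cast (R := ℚ)) hy
  push_cast at hsum' hy'
  refine ratModEq_of_mem_integer (c := ((3 : ℕ) : ℚ)⁻¹ * (d - 2 * e))
    (mul_mem (inv_natCast_mem_integer three_pos hp3)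
      (sub_mem (intCast_mem _ _) (mul_mem (ofNat_mem _ 2) he))) ?_
  rw [hsum', hB]
  push_cast
  linear_combination ((p : ℚ) ^ 2 / 3) * hy'
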